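/- **Setup.** A *constrained triangulation* $\mathcal T=(T,\mathcal C)$ (of a square) consists of a finite oriented simplicial complex $T$ homeomorphic to a closed disk, with exactly four boundary vertices (*corners*) $\mathbf p,\mathbf q,\mathbf r,\mathbf s$, labelled in the cyclic order given by the orientation, and a finite set $\mathcal C$ of *constraints*. Each constraint is a set of vertices of the form $\mathrm{Vert}(S_C)$, where $S_C$ is a set of triangles of $T$ inducing a connected subgraph of the dual graph, and the sets $S_C$ ($C\in\mathcal C$) are pairwise disjoint. A triangle of $T$ is *living* if no constraint contains all of its vertices; let $T_1,\dots,T_n$ be the living triangles. A *drawing* of $\mathcal T$ is a map $\rho:\mathrm{Vert}(T)\to\mathbb C^2$ such that $\rho(C)$ is contained in a line $\ell_C$ for every $C\in\mathcal C$ and $\rho(\mathbf p)+\rho(\mathbf r)=\rho(\mathbf q)+\rho(\mathbf s)$. It is *generic* if moreover no three cyclically consecutive points among $\rho(\mathbf p),\rho(\mathbf q),\rho(\mathbf r),\rho(\mathbf s)$ are collinear, the image of the vertex set of each living triangle is non-collinear, $\rho$ is injective, and $\ell_C\neq\ell_{C'}$ for all distinct constraints with $C\cap C'\ne\emptyset$.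 Let $X(\mathcal T)$ be the closure of the set of generic drawings; $\mathcal T$ is *drawable* if a generic drawing exists. For a drawing $\rho$ let $\mathrm{Area}(T_i)$ be the signed area $\frac12\det\begin{pmatrix}1&1&1\\x_1&x_2&x_3\\y_1&y_2&y_3\end{pmatrix}$ of the image of $T_i$, where $(x_j,y_j)$ are the images of the vertices of $T_i$ in an order given by the orientation. The *area variety* $V(\mathcal T)\subseteq\mathbb P^{n-1}_{\mathbb C}$ is the Zariski closure of the image of $X(\mathcal T)$ under the rational map $\rho\mapsto[\mathrm{Area}(T_1):\dots:\mathrm{Area}(T_n)]$. We call $\mathcal T$ *hyper* if it is drawable and $V(\mathcal T)$ is a hypersurface in $\mathbb P^{n-1}_{\mathbb C}$, i.e. the zero set of a non-constant homogeneous polynomial. An *area polynomial* of $\mathcal T$ is a polynomial $p\in\mathbb Z[A_1,\dots,A_n]$ whose coefficients have no common factor and which generates the homogeneous ideal of $V(\mathcal T)$ in $\mathbb C[A_1,\dots,A_n]$. **Theorem (Mod 2 theorem).** Suppose $\mathcal T$ is hyper. Then $\mathcal T$ has an area polynomial $p$, it is unique up to sign, and $$p\equiv\sigma^d \pmod 2,$$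 where $\sigma=A_1+\dots+A_n$ and $d=\deg p$. -/

import Mathlib

/-!
Constrained triangulations of a square, their drawings in the complex affine plane, the area
variety, and area polynomials.
-/

/-- An oriented finite simplicial complex, homeomorphic to a closed disk, with exactly four boundary
vertices (the corners). `V` is the set of vertices, `F` the set of triangles; `tri t` lists the
vertices of the triangle `t` in one of the three cyclic orders given by its orientation. -/
structure SquareTriangulation (V F : Type*) [Fintype V] where
  tri : F → Fin 3 → V
  tri_injective : ∀ t, Function.Injective (tri t)
  /-- a triangle is determined by its set of vertices -/
  range_tri_injective : Function.Injective fun t => Set.range (tri t)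
  /-- every vertex is a vertex of some triangle -/
  exists_tri : ∀ v, ∃ t, v ∈ Set.range (tri t)
  /-- the geometric realization (in barycentric coordinates) is homeomorphic to a closed disk -/
  disk : Nonempty
    ({x : V → ℝ | x ∈ stdSimplex ℝ V ∧ ∃ t, ∀ v, x v ≠ 0 → v ∈ Set.range (tri t)} ≃ₜ
      Metric.closedBall (0 : EuclideanSpace ℝ (Fin 2)) 1)
  /-- the triangles are coherently oriented: no directed edge occurs twice -/
  coherent : Function.Injective fun e : F × Fin 3 => (tri e.1 e.2, tri e.1 (e.2 + 1))
  /-- the corners `p, q, r, s`, in this order -/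
  corner : Fin 4 → V
  corner_injective : Function.Injective corner
  /-- the directed edges that lie on the boundary (the reversed edge belongs to no triangle) are
  exactly the four edges `pq, qr, rs, sp` -/
  boundary : ∀ v w,
    ((∃ t i, tri t i = v ∧ tri t (i + 1) = w) ∧ ¬ ∃ t i, tri t i = w ∧ tri t (i + 1) = v) ↔
      ∃ i, corner i = v ∧ corner (i + 1) = w

namespace SquareTriangulation

variable {V F : Type*} [Fintype V] (T : SquareTriangulation V F)

/-- The dual graph: two triangles are adjacent if they share an edge. -/
def dualGraph : SimpleGraph F where
  Adj t u := t ≠ u ∧ ∃ v w, v ≠ w ∧ {v, w} ⊆ Set.range (T.tri t) ∩ Set.range (T.tri u)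
  symm := ⟨fun _ _ ⟨h, v, w, hvw, hs⟩ => ⟨h.symm, v, w, hvw, fun _ hx => (hs hx).symm⟩⟩
  loopless := ⟨fun _ h => h.1 rfl⟩

/-- The set of vertices of a set of triangles. -/
def vertices (S : Set F) : Set V := ⋃ t ∈ S, Set.range (T.tri t)

end SquareTriangulation

/-- A constrained triangulation: a set of collinearity constraints, each of which is the vertex set
of a contiguous set of triangles, where these sets of triangles are pairwise disjoint. -/
structure ConstrainedTriangulation (V F : Type*) [Fintype V] extends SquareTriangulation V F where
  constraints : Set (Set V)
  exists_regions : ∃ S : constraints → Set F,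
    (∀ C, (toSquareTriangulation.dualGraph.induce (S C)).Connected) ∧
    (∀ C, toSquareTriangulation.vertices (S C) = C) ∧
    Pairwise fun C D => Disjoint (S C) (S D)

/-- The signed area of the triangle with vertices `a, b, c` in the complex affine plane. -/
noncomputable def triangleArea (a b c : Fin 2 → ℂ) : ℂ :=
  1 / 2 * Matrix.det !![1, 1, 1; a 0, b 0, c 0; a 1, b 1, c 1]

section Projective

variable {ι : Type*}

/-- The closure of a subset of projective space in the Zariski topology. -/
def zariskiClosure (S : Set (Projectivization ℂ (ι → ℂ))) : Set (Projectivization ℂ (ι → ℂ)) :=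
  {x | ∀ (d : ℕ) (f : MvPolynomial ι ℂ), f.IsHomogeneous d →
    (∀ y ∈ S, MvPolynomial.eval y.rep f = 0) → MvPolynomial.eval x.rep f = 0}

/-- A hypersurface: the zero set of a non-constant homogeneous polynomial. -/
def IsHypersurface (W : Set (Projectivization ℂ (ι → ℂ))) : Prop :=
  ∃ (d : ℕ) (f : MvPolynomial ι ℂ), 0 < d ∧ f ≠ 0 ∧ f.IsHomogeneous d ∧
    W = {x | MvPolynomial.eval x.rep f = 0}

/-- The homogeneous ideal of a subset of projective space: the ideal generated by the homogeneous
polynomials that vanish on it. -/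
noncomputable def homogeneousVanishingIdeal (W : Set (Projectivization ℂ (ι → ℂ))) :
    Ideal (MvPolynomial ι ℂ) :=
  Ideal.span {f | ∃ d : ℕ, f.IsHomogeneous d ∧ ∀ x ∈ W, MvPolynomial.eval x.rep f = 0}

end Projective

namespace ConstrainedTriangulation

variable {V F : Type*} [Fintype V] (T : ConstrainedTriangulation V F)

/-- A triangle is alive if no constraint contains all of its vertices. -/
def IsAlive (t : F) : Prop := ∀ C ∈ T.constraints, ¬ Set.range (T.tri t) ⊆ C

/-- The living triangles. -/
abbrev Living : Type _ := {t : F // T.IsAlive t}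

noncomputable instance [Finite F] : Fintype T.Living := Fintype.ofFinite _

/-- A drawing: each constraint is mapped into a line, and the corners form a parallelogram. -/
def IsDrawing (ρ : V → Fin 2 → ℂ) : Prop :=
  (∀ C ∈ T.constraints, Collinear ℂ (ρ '' C)) ∧
  ρ (T.corner 0) + ρ (T.corner 2) = ρ (T.corner 1) + ρ (T.corner 3)

/-- A generic drawing: the boundary parallelogram and the living triangles are non-degenerate, `ρ`
is injective, and two distinct intersecting constraints do not lie on the same line. -/
def IsGenericDrawing (ρ : V → Fin 2 → ℂ) : Prop :=
  T.IsDrawing ρ ∧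
  (∀ i : Fin 4,
    ¬ Collinear ℂ {ρ (T.corner i), ρ (T.corner (i + 1)), ρ (T.corner (i + 2))}) ∧
  (∀ t, T.IsAlive t → ¬ Collinear ℂ {ρ (T.tri t 0), ρ (T.tri t 1), ρ (T.tri t 2)}) ∧
  Function.Injective ρ ∧
  (∀ C ∈ T.constraints, ∀ D ∈ T.constraints, C ≠ D → (C ∩ D).Nonempty →
    ¬ Collinear ℂ (ρ '' (C ∪ D)))

/-- The space `X` of drawings: the closure of the set of generic drawings. -/
def drawingSpace : Set (V → Fin 2 → ℂ) := closure {ρ | T.IsGenericDrawing ρ}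

def IsDrawable : Prop := ∃ ρ, T.IsGenericDrawing ρ

/-- The vector of signed areas of the living triangles. -/
noncomputable def area (ρ : V → Fin 2 → ℂ) (t : T.Living) : ℂ :=
  triangleArea (ρ (T.tri t 0)) (ρ (T.tri t 1)) (ρ (T.tri t 2))

/-- The area variety: the Zariski closure of the image of `X` under the rational map `area` to the
projective space with one coordinate for each living triangle. -/
def areaVariety : Set (Projectivization ℂ (T.Living → ℂ)) :=
  zariskiClosure
    {y | ∃ ρ ∈ T.drawingSpace, ∃ h : T.area ρ ≠ 0, y = Projectivization.mk ℂ (T.area ρ) h}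

/-- `T` is hyper if it is drawable and its area variety is a hypersurface. -/
def IsHyper : Prop := T.IsDrawable ∧ IsHypersurface T.areaVariety

/-- An area polynomial: an integer polynomial whose coefficients have no common factor and which
generates the ideal of the area variety. -/
def IsAreaPolynomial (p : MvPolynomial T.Living ℤ) : Prop :=
  (∀ k : ℤ, (∀ m, k ∣ p.coeff m) → IsUnit k) ∧
  homogeneousVanishingIdeal T.areaVariety =
    Ideal.span {MvPolynomial.map (Int.castRingHom ℂ) p}

end ConstrainedTriangulation

/-! Existence and uniqueness. A generic drawing has nonzero total area, so the area variety is
nonempty; by the Nullstellensatz its ideal is generated by a single squarefree homogeneous `g`.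
Every field automorphism of `ℂ` permutes the generic drawings and commutes with taking areas, so `g`
divides all its conjugates. Hence the ratios of its coefficients are fixed by all automorphisms,
i.e. rational, and `g` can be rescaled to a primitive integer polynomial. Gauss's lemma gives
uniqueness up to sign.

Reduction mod 2. This is Monsky's equidissection argument, run over all generic drawings at once.
For every valuation, Sperner's lemma yields a triangle whose determinant is at least as large as
that of the corner parallelogram. Hence no valuation makes all the ratios `2 * A_t / ∑ A_u` smaller
than `1`, and since valuation rings dominate local rings, these ratios satisfy an integer relation
with constant term `1` (`exists_constantCoeff_eq_one`). Clearing the denominator `σ = ∑ A_u` gives a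
homogeneous integer polynomial `h` in the ideal with `h ≡ σ ^ n` mod 2, since every other term
carries a factor 2. By Gauss's lemma `p` divides `h` over `ℤ`; as `σ` is prime over `ZMod 2`, `p`
reduces to a power of `σ`, and homogeneity fixes the exponent. -/

namespace MvPolynomial

/-! ### Homogeneous polynomials and their divisors. -/

section Homogeneous

variable {σ R : Type*}

theorem IsHomogeneous.eval_smul [CommSemiring R] {f : MvPolynomial σ R} {d : ℕ}
    (hf : f.IsHomogeneous d) (c : R) (x : σ → R) : eval (c • x) f = c ^ d * eval x f := by
  rw [eval_eq, eval_eq, Finset.mul_sum]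
  refine Finset.sum_congr rfl fun m hm => ?_
  have hdeg : m.degree = d := by
    rw [Finsupp.degree_eq_weight_one]
    exact hf (mem_support_iff.mp hm)
  simp only [Pi.smul_apply, smul_eq_mul, mul_pow, Finset.prod_mul_distrib]
  rw [Finset.prod_pow_eq_pow_sum, ← hdeg, Finsupp.degree_apply]
  ring

/-- Over a domain both the lowest degree (the order as a power series) and the top degree are
additive on products; they agree for `f`, hence for each factor. -/
theorem IsHomogeneous.of_dvd [CommRing R] [IsDomain R] {f g : MvPolynomial σ R} {d : ℕ}
    (hf : f.IsHomogeneous d) (hf0 : f ≠ 0) (hgf : g ∣ f) : g.IsHomogeneous g.totalDegree := by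
  obtain ⟨h, rfl⟩ := hgf
  have hg0 : g ≠ 0 := left_ne_zero_of_mul hf0
  have hh0 : h ≠ 0 := right_ne_zero_of_mul hf0
  have htot : g.totalDegree + h.totalDegree = d := by
    rw [← totalDegree_mul_of_isDomain hg0 hh0, hf.totalDegree hf0]
  have hord : (d : ℕ∞) ≤ (g : MvPowerSeries σ R).order + (h : MvPowerSeries σ R).order := by
    rw [← MvPowerSeries.order_mul, ← coe_mul]
    refine MvPowerSeries.le_order fun m hm => ?_
    rw [coeff_coe]
    by_contra hne
    have : m.degree = d := by
      rw [Finsupp.degree_eq_weight_one]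
      exact hf hne
    simp [this] at hm
  have hle : (h : MvPowerSeries σ R).order ≤ h.totalDegree := by
    obtain ⟨m, hm⟩ := ne_zero_iff.mp hh0
    refine (MvPowerSeries.order_le (d := m) (by rwa [coeff_coe])).trans ?_
    exact_mod_cast le_totalDegree (mem_support_iff.mpr hm)
  intro m hm
  refine (DFunLike.congr_fun Finsupp.degree_eq_weight_one m).symm.trans ?_
  have h1 : (g : MvPowerSeries σ R).order ≤ m.degree :=
    MvPowerSeries.order_le (by rwa [coeff_coe])
  have h2 : m.degree ≤ g.totalDegree := le_totalDegree (mem_support_iff.mpr hm)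
  have h3 : d ≤ m.degree + h.totalDegree := by exact_mod_cast hord.trans (add_le_add h1 hle)
  omega

end Homogeneous

/-! ### Gauss's lemma and descent of divisibility. -/

section Primitive

attribute [local instance] algebraMvPolynomial

variable {σ : Type*}

/-- The coefficients of an integer polynomial have no common factor. -/
def HasCoprimeCoeffs (p : MvPolynomial σ ℤ) : Prop := ∀ k : ℤ, (∀ m, k ∣ p.coeff m) → IsUnit k

theorem HasCoprimeCoeffs.ne_zero {p : MvPolynomial σ ℤ} (hp : p.HasCoprimeCoeffs) : p ≠ 0 := by
  rintro rfl
  exact not_isUnit_zero (hp 0 (by simp))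

/-- The prime factors of `k` are cancelled one by one: each stays prime in the polynomial ring and
cannot divide `p`, so it divides the cofactor. -/
theorem HasCoprimeCoeffs.dvd_of_dvd_C_mul {p q : MvPolynomial σ ℤ} (hp : p.HasCoprimeCoeffs)
    {k : ℤ} (hk : k ≠ 0) (h : p ∣ C k * q) : p ∣ q := by
  induction k using UniqueFactorizationMonoid.induction_on_prime generalizing q with
  | h₁ => exact absurd rfl hk
  | h₂ x hx => exact ((hx.map C).dvd_mul_left).mp h
  | h₃ a l ha hl ih =>
    refine ih ha ?_
    rw [C_mul, mul_assoc] at h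
    obtain ⟨r, hr⟩ := h
    have hprime : Prime (C l : MvPolynomial σ ℤ) := (prime_C_iff σ).mpr hl
    rcases hprime.dvd_or_dvd (hr ▸ dvd_mul_right _ _ : C l ∣ p * r) with hlp | ⟨s, rfl⟩
    · exact absurd (hp l (C_dvd_iff_dvd_coeff _ _ |>.mp hlp)) hl.not_isUnit
    · refine ⟨s, mul_left_cancel₀ hprime.ne_zero ?_⟩
      rw [hr]
      ring

theorem exists_C_mul_eq_map (r : MvPolynomial σ ℚ) :
    ∃ k : ℤ, k ≠ 0 ∧ ∃ s : MvPolynomial σ ℤ, C (k : ℚ) * r = map (Int.castRingHom ℚ) s := by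
  obtain ⟨⟨s, ⟨_, k, hk, rfl⟩⟩, hs⟩ :=
    IsLocalization.surj ((nonZeroDivisors ℤ).map (C : ℤ →+* MvPolynomial σ ℤ)) r
  refine ⟨k, nonZeroDivisors.ne_zero hk, s, ?_⟩
  have hs' : r * map (algebraMap ℤ ℚ) (C k) = map (algebraMap ℤ ℚ) s := hs
  rw [mul_comm, ← algebraMap_int_eq, ← hs', map_C, eq_intCast]

/-- A `K`-linear retraction `L → K`, applied to the coefficients of the quotient, commutes with
multiplication by `p` and fixes `q`. -/
theorem dvd_of_map_dvd_map {K L : Type*} [Field K] [Field L] [Algebra K L]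
    {p q : MvPolynomial σ K} (h : map (algebraMap K L) p ∣ map (algebraMap K L) q) : p ∣ q := by
  obtain ⟨r, hr⟩ := h
  obtain ⟨π, hπ⟩ := (Algebra.linearMap K L).exists_leftInverse_of_injective
    (LinearMap.ker_eq_bot.mpr (algebraMap K L).injective)
  have hπ' (a : K) : π (algebraMap K L a) = a := LinearMap.congr_fun hπ a
  refine ⟨∑ m ∈ r.support, monomial m (π (r.coeff m)), ?_⟩
  have hc (m) : coeff m (∑ m ∈ r.support, monomial m (π (r.coeff m))) = π (r.coeff m) := by
    classical
    simp only [coeff_sum, coeff_monomial, Finset.sum_ite_eq', mem_support_iff]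
    split_ifs with h0
    · rfl
    · simp [not_not.mp h0]
  ext m
  classical
  rw [← hπ' (coeff m q), ← coeff_map, hr, coeff_mul, coeff_mul, map_sum]
  refine Finset.sum_congr rfl fun x _ => ?_
  rw [hc, coeff_map, ← Algebra.smul_def, map_smul, smul_eq_mul]

theorem HasCoprimeCoeffs.dvd_of_map_dvd_map {L : Type*} [Field L] [CharZero L]
    {p q : MvPolynomial σ ℤ} (hp : p.HasCoprimeCoeffs)
    (h : map (Int.castRingHom L) p ∣ map (Int.castRingHom L) q) : p ∣ q := by
  have hcomp : Int.castRingHom L = (algebraMap ℚ L).comp (Int.castRingHom ℚ) :=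
    RingHom.ext_int _ _
  rw [hcomp, ← map_map, ← map_map] at h
  obtain ⟨r, hr⟩ := MvPolynomial.dvd_of_map_dvd_map h
  obtain ⟨k, hk, s, hs⟩ := exists_C_mul_eq_map r
  refine hp.dvd_of_dvd_C_mul hk ⟨s, ?_⟩
  apply map_injective (Int.castRingHom ℚ) Int.cast_injective
  rw [map_mul, map_mul, ← hs, hr, map_C]
  simp only [eq_intCast]
  ring

theorem HasCoprimeCoeffs.eq_or_eq_neg {L : Type*} [Field L] [CharZero L]
    {p q : MvPolynomial σ ℤ} (hp : p.HasCoprimeCoeffs) (hq : q.HasCoprimeCoeffs)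
    (h : Associated (map (Int.castRingHom L) p) (map (Int.castRingHom L) q)) :
    q = p ∨ q = -p := by
  obtain ⟨u, hu⟩ := associated_of_dvd_dvd (hp.dvd_of_map_dvd_map h.dvd)
    (hq.dvd_of_map_dvd_map h.dvd')
  obtain ⟨k, hk, hku⟩ := isUnit_iff_eq_C_of_isReduced.mp u.isUnit
  rw [hku] at hu
  rcases Int.isUnit_iff.mp hk with rfl | rfl
  · left; simpa using hu.symm
  · right; simpa using hu.symm

theorem HasCoprimeCoeffs.neg {p : MvPolynomial σ ℤ} (hp : p.HasCoprimeCoeffs) :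
    (-p).HasCoprimeCoeffs :=
  fun k hk => hp k fun m => by simpa using hk m

theorem exists_hasCoprimeCoeffs_eq_C_mul {s : MvPolynomial σ ℤ} (hs : s ≠ 0) :
    ∃ k : ℤ, k ≠ 0 ∧ ∃ p : MvPolynomial σ ℤ, p.HasCoprimeCoeffs ∧ s = C k * p := by
  set k := s.support.gcd s.coeff with hk
  have hdvd (m) : k ∣ s.coeff m := by
    by_cases hm : m ∈ s.support
    · exact Finset.gcd_dvd hm
    · rw [notMem_support_iff.mp hm]; exact dvd_zero _
  have hk0 : k ≠ 0 := by
    intro h0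
    obtain ⟨m, hm⟩ := ne_zero_iff.mp hs
    exact hm (zero_dvd_iff.mp (h0 ▸ hdvd m))
  obtain ⟨p, hp⟩ := (C_dvd_iff_dvd_coeff k s).mpr hdvd
  refine ⟨k, hk0, p, fun l hl => ?_, hp⟩
  have : k * l ∣ k := by
    conv_rhs => rw [hk]
    refine Finset.dvd_gcd fun m _ => ?_
    rw [hp, coeff_C_mul]
    exact mul_dvd_mul_left k (hl m)
  exact isUnit_of_dvd_one ((mul_dvd_mul_iff_left hk0).mp (by simpa using this))

theorem exists_hasCoprimeCoeffs_associated {L : Type*} [Field L] [CharZero L]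
    {r : MvPolynomial σ ℚ} (hr : r ≠ 0) :
    ∃ p : MvPolynomial σ ℤ, p.HasCoprimeCoeffs ∧
      Associated (map (Int.castRingHom L) p) (map (algebraMap ℚ L) r) := by
  obtain ⟨k, hk, s, hs⟩ := exists_C_mul_eq_map r
  have hs0 : s ≠ 0 := by
    rintro rfl
    simp [hk, hr] at hs
  obtain ⟨l, hl, p, hp, rfl⟩ := exists_hasCoprimeCoeffs_eq_C_mul hs0
  refine ⟨p, hp, ?_⟩
  have hcomp : Int.castRingHom L = (algebraMap ℚ L).comp (Int.castRingHom ℚ) :=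
    RingHom.ext_int _ _
  have key := congrArg (map (algebraMap ℚ L)) hs
  rw [map_map, ← hcomp] at key
  rw [map_mul, map_mul, map_C, map_C, eq_intCast, map_intCast] at key
  have hunit (j : ℤ) (hj : j ≠ 0) : IsUnit (C (j : L) : MvPolynomial σ L) :=
    (IsUnit.mk0 (j : L) (by exact_mod_cast hj)).map C
  rw [← associated_isUnit_mul_left_iff (hunit l hl), ← key,
    associated_isUnit_mul_left_iff (hunit k hk)]
  rfl

end Primitive

end MvPolynomial

/-! ### Field automorphisms and rationality of coefficients. -/

/-- `K` is an algebraic closure of the polynomial algebra generated by `v`, so automorphisms of that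
algebra extend to `K`. -/
theorem IsTranscendenceBasis.exists_ringEquiv {R K ι : Type*} [CommRing R] [Field K] [IsAlgClosed K]
    [Algebra R K] {v : ι → K} (hv : IsTranscendenceBasis R v)
    (φ : MvPolynomial ι R ≃+* MvPolynomial ι R) :
    ∃ Φ : K ≃+* K, ∀ q, Φ (MvPolynomial.aeval v q) = MvPolynomial.aeval v (φ q) := by
  have := IsAlgClosed.isAlgClosure_of_transcendence_basis v hv
  have : Nontrivial R := RingHom.domain_nontrivial (algebraMap R K)
  let a := hv.1.aevalEquiv
  let e := (a.symm.toRingEquiv.trans φ).trans a.toRingEquiv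
  refine ⟨IsAlgClosure.equivOfEquiv K K e, fun q => ?_⟩
  have h := IsAlgClosure.equivOfEquiv_algebraMap K K e (a q)
  have ha (q) : algebraMap _ K (a q) = MvPolynomial.aeval v q :=
    hv.1.algebraMap_aevalEquiv q
  rw [ha] at h
  rw [h, ← ha]
  simp [e]

/-- The fixed field of the automorphisms of an algebraically closed field of characteristic zero. -/
theorem IsAlgClosed.mem_range_algebraMap_rat_of_forall_ringEquiv {K : Type*} [Field K]
    [IsAlgClosed K] [CharZero K] {x : K} (hx : ∀ τ : K ≃+* K, τ x = x) :
    x ∈ Set.range (algebraMap ℚ K) := by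
  -- If `x` is algebraic, automorphisms of the algebraic closure of `ℚ` extend to `K` by acting on
  -- coefficients, and Galois theory applies. Otherwise `x` belongs to a transcendence basis and is
  -- moved by the shift `X b ↦ X b + 1`.
  by_cases halg : IsAlgebraic ℚ x
  · let k := algebraicClosure ℚ K
    have : IsAlgClosure ℚ k := algebraicClosure.isAlgClosure ℚ K
    have : Normal ℚ k := IsAlgClosure.normal ℚ k
    have : IsGalois ℚ k := {}
    obtain ⟨ι, v, hv⟩ := exists_isTranscendenceBasis' k K
    have hxk : x ∈ k := (mem_algebraicClosure_iff).mpr halg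
    obtain ⟨y, hy⟩ := (InfiniteGalois.mem_range_algebraMap_iff_fixed (k := ℚ) (⟨x, hxk⟩ : k)).mpr
      fun f => by
        obtain ⟨Φ, hΦ⟩ := hv.exists_ringEquiv (MvPolynomial.mapEquiv _ f.toRingEquiv)
        have := hΦ (MvPolynomial.C ⟨x, hxk⟩)
        simp only [MvPolynomial.aeval_C, MvPolynomial.mapEquiv_apply, MvPolynomial.map_C] at this
        apply Subtype.ext
        refine Eq.trans this.symm ?_
        exact hx Φ
    exact ⟨y, congrArg Subtype.val hy⟩
  · obtain ⟨B, hxB, hB⟩ := exists_isTranscendenceBasis_superset (R := ℚ) (s := {x})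
      (algebraicIndependent_unique_type_iff.mpr halg)
    let φ : MvPolynomial B ℚ ≃ₐ[ℚ] MvPolynomial B ℚ :=
      AlgEquiv.ofAlgHom (MvPolynomial.aeval fun b => MvPolynomial.X b + 1)
        (MvPolynomial.aeval fun b => MvPolynomial.X b - 1) (by ext; simp) (by ext; simp)
    obtain ⟨Φ, hΦ⟩ := hB.exists_ringEquiv φ.toRingEquiv
    have := hΦ (MvPolynomial.X ⟨x, hxB rfl⟩)
    simp [φ, hx] at this

namespace MvPolynomial

variable {σ K : Type*} [Field K]

/-- A conjugate of `g` has the same degree as `g`, so it is a constant multiple of it, and ratios of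
coefficients are fixed by every `τ`. -/
theorem exists_hasCoprimeCoeffs_associated_of_forall_dvd_map [IsAlgClosed K] [CharZero K]
    {g : MvPolynomial σ K} (hg : g ≠ 0) (h : ∀ τ : K ≃+* K, g ∣ map (τ : K →+* K) g) :
    ∃ p : MvPolynomial σ ℤ, p.HasCoprimeCoeffs ∧ Associated (map (Int.castRingHom K) p) g := by
  obtain ⟨n, hn⟩ := ne_zero_iff.mp hg
  have hrat (m) : g.coeff m / g.coeff n ∈ Set.range (algebraMap ℚ K) := by
    refine IsAlgClosed.mem_range_algebraMap_rat_of_forall_ringEquiv fun τ => ?_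
    obtain ⟨q, hq⟩ := h τ
    have hmap0 : map (τ : K →+* K) g ≠ 0 := by
      rwa [Ne, map_eq_zero_iff _ (map_injective _ τ.injective)]
    have hq0 : q ≠ 0 := right_ne_zero_of_mul (hq ▸ hmap0)
    have hdeg : q.totalDegree = 0 := by
      have := congrArg totalDegree hq
      rw [totalDegree_mul_of_isDomain hg hq0, totalDegree, support_map_of_injective _ τ.injective,
        ← totalDegree] at this
      omega
    rw [totalDegree_eq_zero_iff_eq_C] at hdeg
    have hc (m) : τ (g.coeff m) = g.coeff m * q.coeff 0 := by
      have := congrArg (coeff m) hq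
      rw [hdeg, mul_comm, coeff_C_mul, coeff_map, mul_comm] at this
      exact this
    have hu : q.coeff 0 ≠ 0 := by
      intro h0
      rw [h0, C_0] at hdeg
      exact hq0 hdeg
    rw [map_div₀, hc, hc]
    field_simp
  have hmem : C (g.coeff n)⁻¹ * g ∈ Set.range (map (σ := σ) (algebraMap ℚ K)) := by
    rw [mem_range_map_iff_coeffs_subset]
    intro c hc
    obtain ⟨m, hm, rfl⟩ := mem_coeffs_iff.mp hc
    rw [coeff_C_mul, inv_mul_eq_div]
    exact hrat m
  obtain ⟨r, hr⟩ := hmem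
  have hunit : IsUnit (C (g.coeff n)⁻¹ : MvPolynomial σ K) :=
    (IsUnit.mk0 _ (inv_ne_zero hn)).map C
  have hr0 : r ≠ 0 := by
    rintro rfl
    rw [map_zero] at hr
    exact mul_ne_zero hunit.ne_zero hg hr.symm
  obtain ⟨p, hp, hpr⟩ := exists_hasCoprimeCoeffs_associated (L := K) hr0
  refine ⟨p, hp, ?_⟩
  rwa [hr, associated_isUnit_mul_right_iff hunit] at hpr

end MvPolynomial

/-! ### The homogeneous Nullstellensatz for hypersurfaces. -/

section Projective

open MvPolynomial

variable {ι : Type*}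

theorem eval_rep_eq_zero_of_mem_homogeneousVanishingIdeal
    {W : Set (Projectivization ℂ (ι → ℂ))} {f : MvPolynomial ι ℂ}
    (hf : f ∈ homogeneousVanishingIdeal W) {x : Projectivization ℂ (ι → ℂ)} (hx : x ∈ W) :
    eval x.rep f = 0 := by
  have : homogeneousVanishingIdeal W ≤ RingHom.ker (eval x.rep) :=
    Ideal.span_le.mpr fun q ⟨_, _, hq⟩ => hq x hx
  exact this hf

theorem MvPolynomial.IsHomogeneous.eval_rep_mk_eq_zero_iff {f : MvPolynomial ι ℂ} {d : ℕ}
    (hf : f.IsHomogeneous d) {x : ι → ℂ} (hx : x ≠ 0) :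
    eval (Projectivization.mk ℂ x hx).rep f = 0 ↔ eval x f = 0 := by
  obtain ⟨a, ha⟩ := Projectivization.exists_smul_eq_mk_rep ℂ x hx
  rw [← ha, Units.smul_def, hf.eval_smul, mul_eq_zero]
  simp

/-- The vanishing ideal of a nonempty hypersurface is principal. -/
theorem IsHypersurface.exists_homogeneousVanishingIdeal_eq_span [Finite ι]
    {W : Set (Projectivization ℂ (ι → ℂ))} (hW : IsHypersurface W) (hne : W.Nonempty) :
    ∃ g : MvPolynomial ι ℂ, g ≠ 0 ∧ g.IsHomogeneous g.totalDegree ∧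
      homogeneousVanishingIdeal W = Ideal.span {g} := by
  obtain ⟨d, f, -, hf0, hf, rfl⟩ := hW
  let _ := UniqueFactorizationMonoid.strongNormalizationMonoid (α := MvPolynomial ι ℂ)
  set g := UniqueFactorizationMonoid.radical f with hg
  have hgf : g ∣ f := UniqueFactorizationMonoid.radical_dvd_self
  have hghom := hf.of_dvd hf0 hgf
  refine ⟨g, ne_zero_of_dvd_ne_zero hf0 hgf, hghom, le_antisymm ?_ ?_⟩
  · refine Ideal.span_le.mpr ?_
    rintro q ⟨e, hq, hqW⟩
    have hrad : q ∈ (Ideal.span {f}).radical := by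
      rw [← vanishingIdeal_zeroLocus_eq_radical (K := ℂ)]
      intro x hx
      have hfx : eval x f = 0 := hx f (Ideal.mem_span_singleton_self f)
      change eval x q = 0
      -- The origin is no projective point; a point of `W` is needed to rule out that `q` is a
      -- nonzero constant.
      by_cases hx0 : x = 0
      · obtain ⟨y, hy⟩ := hne
        rw [hx0, ← zero_smul ℂ y.rep, hq.eval_smul, hqW y hy, mul_zero]
      · exact (hq.eval_rep_mk_eq_zero_iff hx0).mp
          (hqW _ ((hf.eval_rep_mk_eq_zero_iff hx0).mpr hfx))
    obtain ⟨n, hn⟩ := hrad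
    rw [SetLike.mem_coe, Ideal.mem_span_singleton, hg]
    exact (UniqueFactorizationMonoid.exists_dvd_pow_iff_radical_dvd hf0).mp
      ⟨n, Ideal.mem_span_singleton.mp hn⟩
  · rw [Ideal.span_singleton_le_iff_mem]
    refine Ideal.subset_span ⟨_, hghom, fun x hx => ?_⟩
    obtain ⟨n, q, hq⟩ := UniqueFactorizationMonoid.exists_dvd_radical_self_pow hf0
    have := congrArg (eval x.rep) hq
    rw [map_pow, map_mul, show eval x.rep f = 0 from hx, zero_mul] at this
    exact eq_zero_of_pow_eq_zero this

end Projective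

/-! ### Determinants and collinearity. -/

section TriangleDet

variable {R S : Type*} [CommRing R] [CommRing S]

/-- The determinant of the edge vectors of a plane triangle: twice its signed area. -/
def triangleDet (a b c : Fin 2 → R) : R :=
  (b 0 - a 0) * (c 1 - a 1) - (c 0 - a 0) * (b 1 - a 1)

theorem map_triangleDet (f : R →+* S) (a b c : Fin 2 → R) :
    triangleDet (f ∘ a) (f ∘ b) (f ∘ c) = f (triangleDet a b c) := by
  simp [triangleDet]

theorem triangleArea_eq (a b c : Fin 2 → ℂ) : triangleArea a b c = 1 / 2 * triangleDet a b c := by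
  simp only [triangleArea, triangleDet, Matrix.det_fin_three, Matrix.of_apply, Matrix.cons_val]
  ring

theorem triangleDet_eq_zero_of_collinear {K : Type*} [Field K] {a b c : Fin 2 → K}
    (h : Collinear K {a, b, c}) : triangleDet a b c = 0 := by
  obtain ⟨p, w, hw⟩ := (collinear_iff_exists_forall_eq_smul_vadd (k := K) _).mp h
  obtain ⟨r, rfl⟩ := hw a (by simp)
  obtain ⟨s, rfl⟩ := hw b (by simp)
  obtain ⟨t, rfl⟩ := hw c (by simp)
  simp only [triangleDet, vadd_eq_add, Pi.add_apply, Pi.smul_apply, smul_eq_mul]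
  ring

theorem collinear_of_triangleDet_eq_zero {K : Type*} [Field K] {a b c : Fin 2 → K}
    (h : triangleDet a b c = 0) : Collinear K {a, b, c} := by
  unfold triangleDet at h
  by_cases hab : b = a
  · subst hab
    simpa using collinear_pair K b c
  rw [collinear_iff_of_mem (p₀ := a) (by simp)]
  by_cases h0 : b 0 - a 0 = 0
  · have h1 : b 1 - a 1 ≠ 0 := by
      intro h1
      apply hab
      ext i
      fin_cases i
      · exact sub_eq_zero.mp h0
      · exact sub_eq_zero.mp h1
    refine ⟨b - a, ?_⟩
    simp only [Set.mem_insert_iff, Set.mem_singleton_iff, forall_eq_or_imp, forall_eq]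
    refine ⟨⟨0, by simp⟩, ⟨1, by simp⟩, ⟨(c 1 - a 1) / (b 1 - a 1), ?_⟩⟩
    ext i
    fin_cases i
    · simp only [Fin.zero_eta, vadd_eq_add, Pi.add_apply, Pi.smul_apply, Pi.sub_apply, smul_eq_mul]
      rw [h0] at h ⊢
      have : c 0 - a 0 = 0 := by
        have h' : (c 0 - a 0) * (b 1 - a 1) = 0 := by linear_combination -h
        exact (mul_eq_zero.mp h').resolve_right h1
      linear_combination this
    · simp only [Fin.mk_one, vadd_eq_add, Pi.add_apply, Pi.smul_apply, Pi.sub_apply, smul_eq_mul]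
      field_simp
      ring
  · refine ⟨b - a, ?_⟩
    simp only [Set.mem_insert_iff, Set.mem_singleton_iff, forall_eq_or_imp, forall_eq]
    refine ⟨⟨0, by simp⟩, ⟨1, by simp⟩, ⟨(c 0 - a 0) / (b 0 - a 0), ?_⟩⟩
    ext i
    fin_cases i
    · simp only [Fin.zero_eta, vadd_eq_add, Pi.add_apply, Pi.smul_apply, Pi.sub_apply, smul_eq_mul]
      field_simp
      ring
    · simp only [Fin.mk_one, vadd_eq_add, Pi.add_apply, Pi.smul_apply, Pi.sub_apply, smul_eq_mul]
      field_simp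
      linear_combination h

end TriangleDet

/-! ### Boundary sums: Sperner's lemma and the shoelace formula. -/

namespace SquareTriangulation

variable {V F : Type*} [Fintype V] [Fintype F] (T : SquareTriangulation V F)

/-- An alternating function of directed edges has the same sum around all triangles as around the
boundary. -/
theorem sum_tri_eq_sum_corner {M : Type*} [AddCommGroup M] {φ : V → V → M}
    (hφ : ∀ v w, φ v w = -φ w v) :
    ∑ t, ∑ i, φ (T.tri t i) (T.tri t (i + 1)) = ∑ i, φ (T.corner i) (T.corner (i + 1)) := by
  classical
  let e : F × Fin 3 → V × V := fun e => (T.tri e.1 e.2, T.tri e.1 (e.2 + 1))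
  let b : Fin 4 → V × V := fun i => (T.corner i, T.corner (i + 1))
  have hb : Function.Injective b := fun i j h => T.corner_injective (congrArg Prod.fst h)
  have hmem (v w) : (v, w) ∈ Finset.univ.image e ↔ ∃ t i, T.tri t i = v ∧ T.tri t (i + 1) = w := by
    simp [e]
  have hbmem (v w) : (v, w) ∈ Finset.univ.image b ↔
      (v, w) ∈ Finset.univ.image e ∧ (w, v) ∉ Finset.univ.image e := by
    rw [hmem, hmem, T.boundary]
    simp [b]
  have hsub : Finset.univ.image b ⊆ Finset.univ.image e :=
    fun ⟨v, w⟩ h => ((hbmem v w).mp h).1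
  have hne {x : V × V} (hx : x ∈ Finset.univ.image e) : x.1 ≠ x.2 := by
    obtain ⟨⟨t, i⟩, -, rfl⟩ := Finset.mem_image.mp hx
    intro h
    have hi : ∀ i : Fin 3, i ≠ i + 1 := by decide
    exact hi i (T.tri_injective t h)
  have hL : ∑ t, ∑ i, φ (T.tri t i) (T.tri t (i + 1)) =
      ∑ x ∈ Finset.univ.image e, φ x.1 x.2 := by
    rw [Finset.sum_image T.coherent.injOn, Fintype.sum_prod_type]
  have hR : ∑ i, φ (T.corner i) (T.corner (i + 1)) = ∑ x ∈ Finset.univ.image b, φ x.1 x.2 := by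
    rw [Finset.sum_image hb.injOn]
  rw [hL, hR, ← Finset.sum_sdiff hsub, add_eq_right]
  -- Directed edges off the boundary cancel against their reversals.
  refine Finset.sum_involution (fun x _ => x.swap) ?_ ?_ ?_ ?_
  · intro x _
    rw [hφ x.1 x.2]
    simp
  · intro x hx _ h
    exact hne (Finset.mem_sdiff.mp hx).1 (congrArg Prod.snd h)
  · rintro ⟨v, w⟩ hx
    rw [Finset.mem_sdiff, hbmem] at hx
    rw [Prod.swap_prod_mk, Finset.mem_sdiff, hbmem]
    tauto
  · intro x _
    simp

/-- Sperner's lemma for the coloring of the corners by `0, 1, 1, 2`. -/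
theorem exists_injective_color (c : V → Fin 3) (h0 : c (T.corner 0) = 0) (h1 : c (T.corner 1) = 1)
    (h2 : c (T.corner 2) = 1) (h3 : c (T.corner 3) = 2) :
    ∃ t, Function.Injective fun i => c (T.tri t i) := by
  -- `ψ` is the color difference mod 3, lifted to `{-1, 0, 1}`. Its sum around a triangle vanishes
  -- unless all three colors occur, while around the boundary `0, 1, 1, 2` it is `3`.
  let ψ : Fin 3 → Fin 3 → ℤ := fun i j => if j = i + 1 then 1 else if i = j + 1 then -1 else 0
  have hψ : ∀ i j, ψ i j = -ψ j i := by decide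
  have hcyc : ∀ f : Fin 3 → Fin 3, ∑ i, ψ (f i) (f (i + 1)) ≠ 0 → Function.Injective f := by
    decide
  have hsum := T.sum_tri_eq_sum_corner (φ := fun v w => ψ (c v) (c w)) fun v w => hψ _ _
  by_contra! hno
  have hzero : ∑ t, ∑ i, ψ (c (T.tri t i)) (c (T.tri t (i + 1))) = 0 :=
    Finset.sum_eq_zero fun t _ => by
      by_contra h
      exact hno t (hcyc (fun i => c (T.tri t i)) h)
  rw [hzero, Fin.sum_univ_four] at hsum
  simp only [Fin.isValue, show (0 : Fin 4) + 1 = 1 from rfl, show (1 : Fin 4) + 1 = 2 from rfl,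
    show (2 : Fin 4) + 1 = 3 from rfl, show (3 : Fin 4) + 1 = 0 from rfl, h0, h1, h2, h3] at hsum
  revert hsum
  decide

theorem sum_triangleDet {R : Type*} [CommRing R] (x : V → Fin 2 → R)
    (hx : x (T.corner 0) + x (T.corner 2) = x (T.corner 1) + x (T.corner 3)) :
    ∑ t, triangleDet (x (T.tri t 0)) (x (T.tri t 1)) (x (T.tri t 2)) =
      2 * triangleDet (x (T.corner 0)) (x (T.corner 1)) (x (T.corner 3)) := by
  have hsum := T.sum_tri_eq_sum_corner (φ := fun v w => x v 0 * x w 1 - x v 1 * x w 0)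
    fun v w => by ring
  have ht (t) : triangleDet (x (T.tri t 0)) (x (T.tri t 1)) (x (T.tri t 2)) =
      ∑ i, (x (T.tri t i) 0 * x (T.tri t (i + 1)) 1 - x (T.tri t i) 1 * x (T.tri t (i + 1)) 0) := by
    rw [Fin.sum_univ_three]
    simp only [Fin.isValue, show (0 : Fin 3) + 1 = 1 from rfl, show (1 : Fin 3) + 1 = 2 from rfl,
      show (2 : Fin 3) + 1 = 0 from rfl, triangleDet]
    ring
  rw [Finset.sum_congr rfl fun t _ => ht t, hsum, Fin.sum_univ_four]
  simp only [Fin.isValue, show (0 : Fin 4) + 1 = 1 from rfl, show (1 : Fin 4) + 1 = 2 from rfl,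
    show (2 : Fin 4) + 1 = 3 from rfl, show (3 : Fin 4) + 1 = 0 from rfl, triangleDet]
  have e0 : x (T.corner 2) 0 = x (T.corner 1) 0 + x (T.corner 3) 0 - x (T.corner 0) 0 := by
    rw [← Pi.add_apply, ← hx, Pi.add_apply, add_sub_cancel_left]
  have e1 : x (T.corner 2) 1 = x (T.corner 1) 1 + x (T.corner 3) 1 - x (T.corner 0) 1 := by
    rw [← Pi.add_apply, ← hx, Pi.add_apply, add_sub_cancel_left]
  rw [e0, e1]
  ring

end SquareTriangulation

/-! ### Monsky's coloring and valuations of determinants. -/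

section Monsky

variable {K Γ : Type*} [Field K] [LinearOrderedCommGroupWithZero Γ] (v : Valuation K Γ)

open Classical in
/-- Monsky's coloring of the plane over a valued field. -/
noncomputable def monskyColor (a : Fin 2 → K) : Fin 3 :=
  if v (a 0) < 1 ∧ v (a 1) < 1 then 0 else if v (a 1) ≤ v (a 0) then 1 else 2

variable {v}

theorem monskyColor_eq_zero {a : Fin 2 → K} (h : monskyColor v a = 0) :
    v (a 0) < 1 ∧ v (a 1) < 1 := by
  unfold monskyColor at h
  split_ifs at h with h1 h2
  · exact h1
  · exact absurd h (by decide)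
  · exact absurd h (by decide)

theorem monskyColor_eq_one {a : Fin 2 → K} (h : monskyColor v a = 1) :
    1 ≤ v (a 0) ∧ v (a 1) ≤ v (a 0) := by
  unfold monskyColor at h
  split_ifs at h with h1 h2
  · exact absurd h (by decide)
  · refine ⟨?_, h2⟩
    by_contra! h3
    exact h1 ⟨h3, h2.trans_lt h3⟩
  · exact absurd h (by decide)

theorem monskyColor_eq_two {a : Fin 2 → K} (h : monskyColor v a = 2) :
    1 ≤ v (a 1) ∧ v (a 0) < v (a 1) := by
  unfold monskyColor at h
  split_ifs at h with h1 h2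
  · exact absurd h (by decide)
  · exact absurd h (by decide)
  · rw [not_le] at h2
    refine ⟨?_, h2⟩
    by_contra! h3
    exact h1 ⟨h2.trans h3, h3⟩

/-- Subtracting `a` changes neither `v (b 0)` nor `v (c 1)`, and the product of these diagonal terms
strictly dominates the other product in the determinant. -/
theorem one_le_valuation_triangleDet {a b c : Fin 2 → K} (ha : monskyColor v a = 0)
    (hb : monskyColor v b = 1) (hc : monskyColor v c = 2) : 1 ≤ v (triangleDet a b c) := by
  obtain ⟨ha0, ha1⟩ := monskyColor_eq_zero ha
  obtain ⟨hb0, hb1⟩ := monskyColor_eq_one hb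
  obtain ⟨hc1, hc0⟩ := monskyColor_eq_two hc
  have h1 : v (b 0 - a 0) = v (b 0) := Valuation.map_sub_eq_of_lt_left v (ha0.trans_le hb0)
  have h2 : v (c 1 - a 1) = v (c 1) := Valuation.map_sub_eq_of_lt_left v (ha1.trans_le hc1)
  have h3 : v (c 0 - a 0) < v (c 1) :=
    (v.map_sub _ _).trans_lt (max_lt hc0 (ha0.trans_le hc1))
  have h4 : v (b 1 - a 1) ≤ v (b 0) :=
    (v.map_sub _ _).trans (max_le hb1 (ha1.le.trans hb0))
  have hlt : v ((c 0 - a 0) * (b 1 - a 1)) < v ((b 0 - a 0) * (c 1 - a 1)) := by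
    rw [map_mul, map_mul, h1, h2, mul_comm (v (b 0))]
    exact (mul_le_mul_right h4 _).trans_lt
      (mul_lt_mul_of_pos_right h3 (zero_lt_one.trans_le hb0))
  rw [triangleDet, Valuation.map_sub_eq_of_lt_left v hlt, map_mul, h1, h2]
  exact one_le_mul hb0 hc1

theorem one_le_valuation_triangleDet_of_injective {a : Fin 3 → Fin 2 → K}
    (ha : Function.Injective fun i => monskyColor v (a i)) :
    1 ≤ v (triangleDet (a 0) (a 1) (a 2)) := by
  have hperm : ∀ f : Fin 3 → Fin 3, Function.Injective f →
      (f 0 = 0 ∧ f 1 = 1 ∧ f 2 = 2) ∨ (f 0 = 2 ∧ f 1 = 0 ∧ f 2 = 1) ∨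
      (f 0 = 1 ∧ f 1 = 2 ∧ f 2 = 0) ∨ (f 0 = 0 ∧ f 1 = 2 ∧ f 2 = 1) ∨
      (f 0 = 1 ∧ f 1 = 0 ∧ f 2 = 2) ∨ (f 0 = 2 ∧ f 1 = 1 ∧ f 2 = 0) := by decide
  have hrot (a b c : Fin 2 → K) : triangleDet a b c = triangleDet b c a := by
    simp only [triangleDet]; ring
  have hswap (a b c : Fin 2 → K) : v (triangleDet a b c) = v (triangleDet a c b) := by
    rw [← Valuation.map_neg]
    congr 1
    simp only [triangleDet]
    ring
  rcases hperm _ ha with ⟨h0, h1, h2⟩ | ⟨h0, h1, h2⟩ | ⟨h0, h1, h2⟩ | ⟨h0, h1, h2⟩ |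
    ⟨h0, h1, h2⟩ | ⟨h0, h1, h2⟩
  · exact one_le_valuation_triangleDet h0 h1 h2
  · rw [hrot]; exact one_le_valuation_triangleDet h1 h2 h0
  · rw [← hrot]; exact one_le_valuation_triangleDet h2 h0 h1
  · rw [hswap]; exact one_le_valuation_triangleDet h0 h2 h1
  · rw [hrot, hswap]; exact one_le_valuation_triangleDet h1 h0 h2
  · rw [← hrot, hswap]; exact one_le_valuation_triangleDet h2 h1 h0

namespace SquareTriangulation

variable {V F : Type*} [Fintype V] [Fintype F] (T : SquareTriangulation V F)

theorem exists_one_le_valuation_triangleDet (v : Valuation K Γ) {x : V → Fin 2 → K}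
    (h0 : x (T.corner 0) = ![0, 0]) (h1 : x (T.corner 1) = ![1, 0])
    (h2 : x (T.corner 2) = ![1, 1]) (h3 : x (T.corner 3) = ![0, 1]) :
    ∃ t, 1 ≤ v (triangleDet (x (T.tri t 0)) (x (T.tri t 1)) (x (T.tri t 2))) := by
  obtain ⟨t, ht⟩ := T.exists_injective_color (fun u => monskyColor v (x u))
    (by simp [h0, monskyColor]) (by simp [h1, monskyColor]) (by simp [h2, monskyColor])
    (by simp [h3, monskyColor])
  exact ⟨t, one_le_valuation_triangleDet_of_injective (a := fun i => x (T.tri t i)) ht⟩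

/-- Some triangle is at least as large as the parallelogram, with respect to a given valuation. -/
theorem exists_valuation_triangleDet_le (v : Valuation K Γ) {x : V → Fin 2 → K}
    (hx : x (T.corner 0) + x (T.corner 2) = x (T.corner 1) + x (T.corner 3))
    (hne : triangleDet (x (T.corner 0)) (x (T.corner 1)) (x (T.corner 3)) ≠ 0) :
    ∃ t, v (triangleDet (x (T.corner 0)) (x (T.corner 1)) (x (T.corner 3))) ≤
      v (triangleDet (x (T.tri t 0)) (x (T.tri t 1)) (x (T.tri t 2))) := by
  set p := x (T.corner 0) with hp
  set q := x (T.corner 1) with hq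
  set s := x (T.corner 3) with hs
  have hr : x (T.corner 2) = q + s - p := by rw [← hx]; abel
  set D := triangleDet p q s with hD
  -- Affine coordinates, by Cramer's rule, that take the corners to those of the unit square;
  -- determinants get divided by `D`.
  let y : V → Fin 2 → K := fun u => ![triangleDet p (x u) s / D, triangleDet p q (x u) / D]
  obtain ⟨t, ht⟩ := T.exists_one_le_valuation_triangleDet v (x := y)
    (by simp [y, ← hp, triangleDet])
    (by
      simp only [y, ← hq, ← hD, div_self hne]
      simp [triangleDet])
    (by
      have e1 : triangleDet p (x (T.corner 2)) s = D := by
        rw [hr, hD]; simp only [triangleDet, Pi.add_apply, Pi.sub_apply]; ring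
      have e2 : triangleDet p q (x (T.corner 2)) = D := by
        rw [hr, hD]; simp only [triangleDet, Pi.add_apply, Pi.sub_apply]; ring
      simp only [y, e1, e2, div_self hne])
    (by
      simp only [y, ← hs, ← hD, div_self hne]
      simp [triangleDet])
  refine ⟨t, ?_⟩
  have key : triangleDet (x (T.tri t 0)) (x (T.tri t 1)) (x (T.tri t 2)) =
      D * triangleDet (y (T.tri t 0)) (y (T.tri t 1)) (y (T.tri t 2)) := by
    simp only [y, triangleDet, Matrix.cons_val_zero, Matrix.cons_val_one]
    field_simp
    rw [hD, triangleDet]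
    ring
  rw [key, map_mul]
  exact le_mul_of_one_le_right' ht

end SquareTriangulation

end Monsky

/-! ### Areas of drawings and equations of the area variety. -/

namespace ConstrainedTriangulation

variable {V F : Type*} [Fintype V] (T : ConstrainedTriangulation V F)

theorem area_eq (ρ : V → Fin 2 → ℂ) (t : T.Living) :
    T.area ρ t = 1 / 2 * triangleDet (ρ (T.tri t 0)) (ρ (T.tri t 1)) (ρ (T.tri t 2)) :=
  triangleArea_eq _ _ _

variable {T}

theorem IsDrawing.triangleDet_eq_zero {ρ : V → Fin 2 → ℂ} (hρ : T.IsDrawing ρ) {t : F}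
    (ht : ¬ T.IsAlive t) : triangleDet (ρ (T.tri t 0)) (ρ (T.tri t 1)) (ρ (T.tri t 2)) = 0 := by
  simp only [IsAlive, not_forall, not_not] at ht
  obtain ⟨C, hC, hsub⟩ := ht
  refine triangleDet_eq_zero_of_collinear ((hρ.1 C hC).subset ?_)
  have h (i) : ρ (T.tri t i) ∈ ρ '' C := Set.mem_image_of_mem ρ (hsub ⟨i, rfl⟩)
  rintro _ (rfl | rfl | rfl)
  exacts [h 0, h 1, h 2]

/-- Dead triangles contribute zero, and the factor `1 / 2` in the area cancels the `2` in
`sum_triangleDet`. -/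
theorem IsDrawing.sum_area [Finite F] {ρ : V → Fin 2 → ℂ} (hρ : T.IsDrawing ρ) :
    ∑ t, T.area ρ t = triangleDet (ρ (T.corner 0)) (ρ (T.corner 1)) (ρ (T.corner 3)) := by
  classical
  let _ := Fintype.ofFinite F
  have hsum := T.sum_triangleDet ρ hρ.2
  have hliving : ∑ t : T.Living, triangleDet (ρ (T.tri t 0)) (ρ (T.tri t 1)) (ρ (T.tri t 2)) =
      ∑ t, triangleDet (ρ (T.tri t 0)) (ρ (T.tri t 1)) (ρ (T.tri t 2)) := by
    rw [← Finset.sum_filter_of_ne (p := T.IsAlive)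
      fun t _ h => not_not.mp (mt hρ.triangleDet_eq_zero h)]
    exact (Finset.sum_subtype _ (by simp)
      fun t => triangleDet (ρ (T.tri t 0)) (ρ (T.tri t 1)) (ρ (T.tri t 2))).symm
  simp only [area_eq, ← Finset.mul_sum]
  rw [hliving, hsum]
  ring

theorem IsGenericDrawing.triangleDet_corner_ne_zero {ρ : V → Fin 2 → ℂ}
    (hρ : T.IsGenericDrawing ρ) :
    triangleDet (ρ (T.corner 0)) (ρ (T.corner 1)) (ρ (T.corner 3)) ≠ 0 := by
  intro h
  have h3 : ¬ Collinear ℂ {ρ (T.corner 3), ρ (T.corner 0), ρ (T.corner 1)} := hρ.2.1 3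
  refine h3 (collinear_of_triangleDet_eq_zero ?_)
  rw [← h]
  simp only [triangleDet]
  ring

theorem IsGenericDrawing.sum_area_ne_zero [Finite F] {ρ : V → Fin 2 → ℂ}
    (hρ : T.IsGenericDrawing ρ) : ∑ t, T.area ρ t ≠ 0 := by
  rw [hρ.1.sum_area]
  exact hρ.triangleDet_corner_ne_zero

theorem IsGenericDrawing.area_ne_zero [Finite F] {ρ : V → Fin 2 → ℂ}
    (hρ : T.IsGenericDrawing ρ) : T.area ρ ≠ 0 := by
  intro h
  exact hρ.sum_area_ne_zero (by simp [h])

variable (T)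

theorem continuous_area : Continuous T.area := by
  refine continuous_pi fun t => ?_
  simp only [area_eq, triangleDet]
  fun_prop

/-- A homogeneous polynomial vanishes on the area variety if and only if it vanishes at the areas of
all generic drawings. -/
theorem eval_rep_eq_zero_iff [Finite F] {f : MvPolynomial T.Living ℂ} {d : ℕ}
    (hf : f.IsHomogeneous d) :
    (∀ x ∈ T.areaVariety, MvPolynomial.eval x.rep f = 0) ↔
      ∀ ρ, T.IsGenericDrawing ρ → MvPolynomial.eval (T.area ρ) f = 0 := by
  constructor
  · intro h ρ hρ
    rw [← hf.eval_rep_mk_eq_zero_iff hρ.area_ne_zero]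
    exact h _ fun e g _ hgS => hgS _ ⟨ρ, subset_closure hρ, hρ.area_ne_zero, rfl⟩
  · intro h x hx
    refine hx d f hf ?_
    rintro _ ⟨ρ, hρ, h0, rfl⟩
    rw [hf.eval_rep_mk_eq_zero_iff]
    have hclosed : IsClosed {ρ | MvPolynomial.eval (T.area ρ) f = 0} :=
      isClosed_singleton.preimage ((MvPolynomial.continuous_eval f).comp T.continuous_area)
    exact closure_minimal h hclosed hρ

variable {T}

theorem IsDrawable.areaVariety_nonempty [Finite F] (hT : T.IsDrawable) :
    T.areaVariety.Nonempty := by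
  obtain ⟨ρ, hρ⟩ := hT
  exact ⟨Projectivization.mk ℂ _ hρ.area_ne_zero, fun e g _ hgS =>
    hgS _ ⟨ρ, subset_closure hρ, hρ.area_ne_zero, rfl⟩⟩

/-! ### Automorphisms of the field; existence and uniqueness of the area polynomial. -/

section Automorphism

theorem _root_.Collinear.image_ringEquiv {K ι : Type*} [Field K] {s : Set (ι → K)}
    (hs : Collinear K s) (τ : K ≃+* K) : Collinear K ((fun a => τ ∘ a) '' s) := by
  rw [collinear_iff_exists_forall_eq_smul_vadd] at hs ⊢
  obtain ⟨p, w, h⟩ := hs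
  refine ⟨τ ∘ p, τ ∘ w, ?_⟩
  rintro _ ⟨a, ha, rfl⟩
  obtain ⟨r, rfl⟩ := h a ha
  exact ⟨τ r, by ext i; simp⟩

theorem _root_.collinear_image_ringEquiv_iff {K ι : Type*} [Field K] {s : Set (ι → K)}
    (τ : K ≃+* K) : Collinear K ((fun a => τ ∘ a) '' s) ↔ Collinear K s := by
  refine ⟨fun h => ?_, fun h => h.image_ringEquiv τ⟩
  have := h.image_ringEquiv τ.symm
  rw [Set.image_image] at this
  convert this
  ext a
  simp [Function.comp_def]

/-- Genericity is purely algebraic, so `τ` need not be continuous; the closure in `drawingSpace` is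
avoided by testing on generic drawings only. -/
theorem IsGenericDrawing.ringEquiv_comp {ρ : V → Fin 2 → ℂ} (hρ : T.IsGenericDrawing ρ)
    (τ : ℂ ≃+* ℂ) : T.IsGenericDrawing fun v => τ ∘ ρ v := by
  have himage (s : Set V) : (fun v => τ ∘ ρ v) '' s = (fun a => τ ∘ a) '' (ρ '' s) :=
    (Set.image_image _ _ _).symm
  have htriple (a b c : Fin 2 → ℂ) :
      ({τ ∘ a, τ ∘ b, τ ∘ c} : Set (Fin 2 → ℂ)) = (fun a => τ ∘ a) '' {a, b, c} := by
    simp [Set.image_insert_eq]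
  obtain ⟨⟨hC, hpar⟩, hcorner, hliving, hinj, hCD⟩ := hρ
  refine ⟨⟨fun C hC' => ?_, ?_⟩, fun i => ?_, fun t ht => ?_, ?_, fun C hC D hD hne hCD' => ?_⟩
  · rw [himage]
    exact (hC C hC').image_ringEquiv τ
  · ext i
    simpa using congrArg τ (congrFun hpar i)
  · rw [htriple, collinear_image_ringEquiv_iff]
    exact hcorner i
  · rw [htriple, collinear_image_ringEquiv_iff]
    exact hliving t ht
  · intro v w h
    refine hinj (funext fun i => τ.injective (congrFun h i))
  · rw [himage, collinear_image_ringEquiv_iff]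
    exact hCD C hC D hD hne hCD'

theorem area_ringEquiv_comp (τ : ℂ ≃+* ℂ) (ρ : V → Fin 2 → ℂ) :
    T.area (fun v => τ ∘ ρ v) = τ ∘ T.area ρ := by
  ext t
  rw [Function.comp_apply, area_eq, area_eq, map_mul]
  have := map_triangleDet (τ : ℂ →+* ℂ) (ρ (T.tri t 0)) (ρ (T.tri t 1)) (ρ (T.tri t 2))
  simp only [RingHom.coe_coe] at this
  rw [this, map_div₀, map_one, map_ofNat]

end Automorphism

/-- The ideal of the area variety is generated by an integer polynomial. -/
theorem IsHyper.exists_isAreaPolynomial [Finite F] (hT : T.IsHyper) :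
    ∃ p, T.IsAreaPolynomial p := by
  obtain ⟨g, hg0, hghom, hg⟩ :=
    hT.2.exists_homogeneousVanishingIdeal_eq_span hT.1.areaVariety_nonempty
  have hgT : ∀ ρ, T.IsGenericDrawing ρ → MvPolynomial.eval (T.area ρ) g = 0 :=
    (T.eval_rep_eq_zero_iff hghom).mp fun x hx =>
      eval_rep_eq_zero_of_mem_homogeneousVanishingIdeal
        (hg ▸ Ideal.mem_span_singleton_self g) hx
  obtain ⟨p, hp, hpg⟩ :=
    MvPolynomial.exists_hasCoprimeCoeffs_associated_of_forall_dvd_map hg0 fun τ => by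
      rw [← Ideal.mem_span_singleton, ← hg]
      refine Ideal.subset_span ⟨_, hghom.map _, (T.eval_rep_eq_zero_iff (hghom.map _)).mpr ?_⟩
      intro ρ hρ
      -- The conjugate of `g` vanishes at the areas of `ρ` because `g` vanishes at those of the
      -- conjugate of `ρ` under `τ.symm`.
      have h := hgT _ (hρ.ringEquiv_comp τ.symm)
      rw [area_ringEquiv_comp] at h
      have h' := MvPolynomial.eval₂_comp (τ : ℂ →+* ℂ) (τ.symm ∘ T.area ρ) g
      rw [h, map_zero, ← MvPolynomial.eval_map] at h'
      convert h'.symm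
      ext t
      simp
  exact ⟨p, hp, hg.trans (Ideal.span_singleton_eq_span_singleton.mpr hpg.symm)⟩

theorem IsAreaPolynomial.iff_eq_or_eq_neg {p : MvPolynomial T.Living ℤ} (hp : T.IsAreaPolynomial p)
    (q : MvPolynomial T.Living ℤ) : T.IsAreaPolynomial q ↔ q = p ∨ q = -p := by
  refine ⟨fun hq => ?_, ?_⟩
  · exact MvPolynomial.HasCoprimeCoeffs.eq_or_eq_neg (L := ℂ) hp.1 hq.1
      (Ideal.span_singleton_eq_span_singleton.mp (hp.2.symm.trans hq.2))
  · rintro (rfl | rfl)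
    · exact hp
    · refine ⟨MvPolynomial.HasCoprimeCoeffs.neg hp.1, ?_⟩
      rw [hp.2, map_neg, Ideal.span_singleton_neg]

end ConstrainedTriangulation

/-! ### Homogenizing an integer relation; reduction mod 2. -/

namespace MvPolynomial

variable {ι : Type*} [Fintype ι]

/-- The sum of the variables is prime. -/
theorem prime_sum_X {K : Type*} [Field K] [Nonempty ι] :
    Prime (∑ i, X i : MvPolynomial ι K) := by
  classical
  have hc (i : ι) : coeff (Finsupp.single i 1) (∑ j, X j : MvPolynomial ι K) = 1 := by
    simp [coeff_sum, coeff_X, Finsupp.single_left_inj]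
  obtain ⟨i⟩ := ‹Nonempty ι›
  have h0 : (∑ j, X j : MvPolynomial ι K) ≠ 0 := by
    intro h
    have := hc i
    simp [h] at this
  refine (irreducible_of_totalDegree_eq_one ?_ fun x hx => ?_).prime
  · exact (IsHomogeneous.sum _ _ 1 fun j _ => isHomogeneous_X K j).totalDegree h0
  · exact isUnit_of_dvd_one (hc i ▸ hx (Finsupp.single i 1))

/-- A polynomial relation, with constant coefficient `1`, between the quotients `2 a i / ∑ j, a j`
yields a homogeneous relation between the `a i`, congruent to a power of the sum modulo `2`. -/
theorem exists_isHomogeneous_of_constantCoeff_eq_one {G : MvPolynomial ι ℤ}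
    (hG : constantCoeff G = 1) :
    ∃ (n : ℕ) (h : MvPolynomial ι ℤ), h.IsHomogeneous n ∧
      map (Int.castRingHom (ZMod 2)) h = (∑ i, X i) ^ n ∧
      ∀ a : ι → ℂ, ∑ i, a i ≠ 0 → aeval (fun i => 2 * a i / ∑ j, a j) G = 0 → aeval a h = 0 := by
  set n := G.totalDegree with hn
  -- The degree `k` part of `G`, evaluated at `2 * a i / s`, acquires the factor `(2 / s) ^ k`;
  -- multiplying by `s ^ n` clears denominators.
  refine ⟨n, ∑ k ∈ Finset.range (n + 1), (∑ i, X i) ^ (n - k) * (C (2 ^ k) *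
    homogeneousComponent k G), ?_, ?_, fun a ha haG => ?_⟩
  · refine IsHomogeneous.sum _ _ _ fun k hk => ?_
    have hσ : (∑ i, X i : MvPolynomial ι ℤ).IsHomogeneous 1 :=
      IsHomogeneous.sum _ _ 1 fun j _ => isHomogeneous_X ℤ j
    have := (hσ.pow (n - k)).mul ((homogeneousComponent_isHomogeneous k G).C_mul (2 ^ k))
    rwa [one_mul, Nat.sub_add_cancel (Nat.lt_succ_iff.mp (Finset.mem_range.mp hk))] at this
  · rw [map_sum, Finset.sum_eq_single 0]
    · rw [constantCoeff_eq] at hG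
      simp [homogeneousComponent_zero, hG]
    · intro k _ hk
      have h2 : (Int.castRingHom (ZMod 2)) (2 ^ k) = 0 := by
        rw [map_pow]
        exact zero_pow hk
      rw [map_mul, map_mul, map_C, h2]
      simp
    · simp
  · set s := ∑ j, a j with hs
    have hk (k : ℕ) (hk : k ≤ n) : aeval a ((∑ i, X i) ^ (n - k) * (C (2 ^ k) *
        homogeneousComponent k G)) =
        s ^ n * aeval (fun i => 2 * a i / s) (homogeneousComponent k G) := by
      have h1 : (fun i => 2 * a i / s) = (2 / s) • a := by
        ext i
        simp only [Pi.smul_apply, smul_eq_mul]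
        ring
      have hhom := (homogeneousComponent_isHomogeneous k G).map (algebraMap ℤ ℂ)
      have h2 := hhom.eval_smul (2 / s) a
      rw [eval_map, eval_map, ← aeval_def, ← aeval_def] at h2
      rw [h1, h2, map_mul, map_mul, map_pow, map_sum]
      simp only [aeval_X, algHom_C, ← hs]
      obtain ⟨l, hl⟩ := Nat.exists_eq_add_of_le hk
      rw [hl, Nat.add_sub_cancel_left, div_pow, pow_add]
      field_simp
      simp [mul_comm]
    rw [map_sum, Finset.sum_congr rfl fun k hk' =>
      hk k (Nat.lt_succ_iff.mp (Finset.mem_range.mp hk')), ← Finset.mul_sum, ← map_sum,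
      sum_homogeneousComponent, haG, mul_zero]

end MvPolynomial

/-! ### The integer relation between areas and the mod 2 theorem. -/

namespace ConstrainedTriangulation

open MvPolynomial

variable {V F : Type*} [Fintype V] [Finite F] (T : ConstrainedTriangulation V F)

/-- The quotients of the areas of the living triangles by half the area of the parallelogram satisfy
an integer relation with constant coefficient `1`. -/
theorem exists_constantCoeff_eq_one :
    ∃ G : MvPolynomial T.Living ℤ, constantCoeff G = 1 ∧ ∀ ρ, T.IsGenericDrawing ρ →
      aeval (fun t => 2 * T.area ρ t / ∑ u, T.area ρ u) G = 0 := by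
  let _ := Fintype.ofFinite F
  -- Functions on the set of all generic drawings: a relation in `R` holds for every drawing
  -- simultaneously. `R` need not be a domain, hence the passage to a residue field below.
  let R := {ρ // T.IsGenericDrawing ρ} → ℂ
  let x : V → Fin 2 → R := fun v i ρ => ρ.1 v i
  let D (t : F) : R := triangleDet (x (T.tri t 0)) (x (T.tri t 1)) (x (T.tri t 2))
  let Δ : R := triangleDet (x (T.corner 0)) (x (T.corner 1)) (x (T.corner 3))
  have hx : x (T.corner 0) + x (T.corner 2) = x (T.corner 1) + x (T.corner 3) := by
    ext i ρ
    exact congrFun ρ.2.1.2 i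
  have hΔ (ρ) : Δ ρ ≠ 0 := ρ.2.triangleDet_corner_ne_zero
  have hΔunit : IsUnit Δ := Pi.isUnit_iff.mpr fun ρ => (hΔ ρ).isUnit
  let a (t : T.Living) : R := fun ρ => 2 * T.area ρ.1 t / ∑ u, T.area ρ.1 u
  have haD (t : T.Living) : a t * Δ = D t := by
    ext ρ
    have hD : D t ρ = triangleDet (ρ.1 (T.tri t 0)) (ρ.1 (T.tri t 1)) (ρ.1 (T.tri t 2)) := rfl
    have hsum : ∑ u, T.area ρ.1 u = Δ ρ := ρ.2.1.sum_area
    rw [Pi.mul_apply, hD]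
    simp only [a, area_eq T ρ.1 t, hsum]
    have := hΔ ρ
    field_simp
  have hdead {t : F} (ht : ¬ T.IsAlive t) : D t = 0 := by
    ext ρ
    exact ρ.2.1.triangleDet_eq_zero ht
  let φ : MvPolynomial T.Living ℤ →+* R := (aeval a).toRingHom
  have hφX (t) : φ (X t) = a t := aeval_X a t
  have hφ (G) (ρ : {ρ // T.IsGenericDrawing ρ}) :
      φ G ρ = aeval (fun t => 2 * T.area ρ.1 t / ∑ u, T.area ρ.1 u) G := by
    refine (map_aeval a (Pi.evalRingHom (fun _ => ℂ) ρ) G).trans ?_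
    rw [RingHom.ext_int ((Pi.evalRingHom (fun _ => ℂ) ρ).comp (algebraMap ℤ R)) (algebraMap ℤ ℂ)]
    rfl
  -- Writing `1 = G + H` with `H` in the ideal of the variables forces `G` to have constant term
  -- `1`.
  suffices htop : RingHom.ker φ ⊔ Ideal.span (Set.range X) = ⊤ by
    obtain ⟨G, hG, H, hH, hGH⟩ := Submodule.mem_sup.mp ((Ideal.eq_top_iff_one _).mp htop)
    have hH0 : constantCoeff H = 0 := by
      have hle : Ideal.span (Set.range X) ≤
          RingHom.ker (constantCoeff : MvPolynomial T.Living ℤ →+* ℤ) := by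
        rw [Ideal.span_le]
        rintro _ ⟨t, rfl⟩
        exact constantCoeff_X ℤ t
      exact hle hH
    refine ⟨G, ?_, fun ρ hρ => ?_⟩
    · have := congrArg constantCoeff hGH
      rwa [map_add, hH0, add_zero, map_one] at this
    · have := congrFun (show φ G = 0 from hG) ⟨ρ, hρ⟩
      rwa [hφ] at this
  by_contra hne
  obtain ⟨m, hm, hle⟩ := Ideal.exists_le_maximal _ hne
  have hcomap : (⊥ : Ideal R).comap φ ≤ m := le_sup_left.trans hle
  -- A minimal prime over `RingHom.ker φ` is the contraction of a prime of `R`, which supplies a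
  -- field in which `m` still has a proper image.
  obtain ⟨q, hq, hqm⟩ := Ideal.exists_minimalPrimes_le hcomap
  obtain ⟨Q, hQ, -, rfl⟩ := Ideal.exists_comap_eq_of_mem_minimalPrimes φ q hq
  let ψ : R →+* Q.ResidueField := algebraMap R Q.ResidueField
  have hψ (r) : ψ r = 0 ↔ r ∈ Q := Ideal.algebraMap_residueField_eq_zero
  let θ := ψ.comp φ
  have hθ : RingHom.ker θ.rangeRestrict ≤ m := by
    intro G hG
    refine hqm ?_
    rw [Ideal.mem_comap, ← hψ]
    exact congrArg Subtype.val (show θ.rangeRestrict G = 0 from hG)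
  have hI : m.map θ.rangeRestrict ≠ ⊤ := by
    intro h
    have h2 := Ideal.comap_map_of_surjective _ θ.rangeRestrict_surjective m
    rw [h, Ideal.comap_top] at h2
    refine hm.ne_top (h2.trans (sup_eq_left.mpr hθ)).symm
  -- A valuation ring with the image of `m` among its nonunits: all ratios `a t` get valuation below
  -- `1`, against Monsky's bound.
  obtain ⟨O, -, hO⟩ := Ideal.image_subset_nonunits_valuationSubring _ hI
  have hsmall (t : T.Living) : O.valuation (ψ (a t)) < 1 := by
    rw [← ValuationSubring.mem_nonunits_iff]
    refine hO ⟨θ.rangeRestrict (X t), Ideal.mem_map_of_mem _ ?_, ?_⟩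
    · exact hle (le_sup_right (a := RingHom.ker φ) (Ideal.subset_span ⟨t, rfl⟩))
    · rw [← hφX]
      rfl
  have hψΔ : ψ Δ ≠ 0 := (hΔunit.map ψ).ne_zero
  have hdet (u v w : V) : triangleDet (ψ ∘ x u) (ψ ∘ x v) (ψ ∘ x w) =
      ψ (triangleDet (x u) (x v) (x w)) := map_triangleDet ψ _ _ _
  obtain ⟨t, ht⟩ := T.exists_valuation_triangleDet_le O.valuation (x := fun v => ψ ∘ x v)
    (by
      ext i
      simpa using congrArg ψ (congrFun hx i))
    (by rw [hdet]; exact hψΔ)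
  rw [hdet, hdet] at ht
  change O.valuation (ψ Δ) ≤ O.valuation (ψ (D t)) at ht
  have hpos : 0 < O.valuation (ψ Δ) := by
    rw [zero_lt_iff]
    exact (Valuation.ne_zero_iff _).mpr hψΔ
  by_cases hlive : T.IsAlive t
  · rw [← haD ⟨t, hlive⟩, map_mul, map_mul] at ht
    exact absurd ht (not_le.mpr (mul_lt_of_lt_one_left hpos (hsmall ⟨t, hlive⟩)))
  · rw [hdead hlive, map_zero, map_zero] at ht
    exact absurd ht (not_le.mpr hpos)

variable {T}

theorem IsAreaPolynomial.map_zmod_two_eq {p : MvPolynomial T.Living ℤ} (hp : T.IsAreaPolynomial p)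
    (hT : T.IsDrawable) :
    map (Int.castRingHom (ZMod 2)) p = (∑ t : T.Living, X t) ^ p.totalDegree := by
  obtain ⟨G, hG1, hG⟩ := T.exists_constantCoeff_eq_one
  obtain ⟨n, h, hhom, hmod, hvan⟩ := exists_isHomogeneous_of_constantCoeff_eq_one hG1
  have hmem : map (Int.castRingHom ℂ) h ∈ homogeneousVanishingIdeal T.areaVariety := by
    refine Ideal.subset_span ⟨n, hhom.map _, (T.eval_rep_eq_zero_iff (hhom.map _)).mpr ?_⟩
    intro ρ hρ
    rw [eval_map]
    exact hvan _ hρ.sum_area_ne_zero (hG ρ hρ)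
  rw [hp.2, Ideal.mem_span_singleton] at hmem
  have hph : p ∣ h := MvPolynomial.HasCoprimeCoeffs.dvd_of_map_dvd_map (L := ℂ) hp.1 hmem
  have : Nonempty T.Living := by
    obtain ⟨ρ, hρ⟩ := hT
    by_contra hempty
    rw [not_nonempty_iff] at hempty
    exact hρ.sum_area_ne_zero (by simp)
  have hprime : Prime (∑ t, X t : MvPolynomial T.Living (ZMod 2)) := prime_sum_X
  have hh0 : h ≠ 0 := by
    rintro rfl
    rw [map_zero] at hmod
    exact pow_ne_zero n hprime.ne_zero hmod.symm
  have hphom := hhom.of_dvd hh0 hph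
  have hdvd := map_dvd (map (σ := T.Living) (Int.castRingHom (ZMod 2))) hph
  rw [hmod] at hdvd
  obtain ⟨k, -, hk⟩ := (dvd_prime_pow hprime n).mp hdvd
  obtain ⟨u, hu⟩ := hk.symm
  -- The only unit of a polynomial ring over `ZMod 2` is `1`.
  have hu1 : (u : MvPolynomial T.Living (ZMod 2)) = 1 := by
    obtain ⟨c, hc, hcu⟩ := isUnit_iff_eq_C_of_isReduced.mp u.isUnit
    have : ∀ c : ZMod 2, c ≠ 0 → c = 1 := by decide
    rw [hcu, this c hc.ne_zero, C_1]
  rw [hu1, mul_one] at hu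
  have hσ : (∑ t, X t : MvPolynomial T.Living (ZMod 2)).IsHomogeneous 1 :=
    IsHomogeneous.sum _ _ 1 fun j _ => isHomogeneous_X _ j
  have h1 := hσ.pow k
  have h2 : (map (Int.castRingHom (ZMod 2)) p).IsHomogeneous p.totalDegree := hphom.map _
  rw [← hu] at h2 ⊢
  rw [h2.inj_right h1 (pow_ne_zero k hprime.ne_zero), one_mul]

end ConstrainedTriangulation

theorem mainTheorem4 {V F : Type*} [Fintype V] [Finite F] (T : ConstrainedTriangulation V F)
    (hT : T.IsHyper) :
    (∃ p, ∀ q, T.IsAreaPolynomial q ↔ q = p ∨ q = -p) ∧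
    ∀ p, T.IsAreaPolynomial p →
      MvPolynomial.map (Int.castRingHom (ZMod 2)) p =
        (∑ t : T.Living, MvPolynomial.X t) ^ p.totalDegree := by
  obtain ⟨p, hp⟩ := hT.exists_isAreaPolynomial
  exact ⟨⟨p, hp.iff_eq_or_eq_neg⟩, fun q hq => hq.map_zmod_two_eq hT.1⟩
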